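/- For a group $G$, let $\mathrm{LO}(G)$ be the set of left-orderings of $G$, identified with their positive cones, i.e. the subsets $P\subseteq G$ with $P\cdot P\subseteq P$ and $G=P\sqcup P^{-1}\sqcup\{1\}$. With the topology of a subspace of the product space $2^G$ ($2$ discrete), $\mathrm{LO}(G)$ is a compact Polish space when $G$ is countable. Let $E_{\mathrm{lo}}(G)$ be the equivalence relation on $\mathrm{LO}(G)$ given by $(P,Q)\in E_{\mathrm{lo}}(G)$ if and only if $Q=gPg^{-1}$ for some $g\in G$. For equivalence relations $E$, $F$ on standard Borel spaces $X$, $Y$, write $E\leq_B F$ ($E$ is Borel reducible to $F$) if there is a Borel map $f\colon X\to Y$ such that, for all $x_0,x_1\in X$, $x_0\mathrel{E}x_1$ if and only if $f(x_0)\mathrel{F}f(x_1)$. Let $\mathbb{F}_n$ denote the free group on $n$ generators and $\mathbb{F}_\infty$ the free group on countably infinitely many generators. Proposition. Let $n\geq 2$. Then $E_{\mathrm{lo}}(\mathbb{F}_2)\leq_B E_{\mathrm{lo}}(\mathbb{F}_n)$ and $E_{\mathrm{lo}}(\mathbb{F}_2)\leq_B E_{\mathrm{lo}}(\mathbb{F}_\infty)$.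 -/

import Mathlib

open Topology TopologicalSpace
open scoped Pointwise

/-- A left-ordering of the group `G`, given by its positive cone: a subset `P` of `G` with
`P * P ⊆ P` such that `G` is the disjoint union of `P`, `P⁻¹` and `{1}`. The type `LO G` is thus
the set of all left-orderings of `G`. -/
@[ext]
structure LO (G : Type*) [Group G] where
  /-- The positive cone `{g | 1 < g}`. -/
  carrier : Set G
  mul_subset : carrier * carrier ⊆ carrier
  union_eq : carrier ∪ carrier⁻¹ ∪ {1} = Set.univ
  disjoint_inv : Disjoint carrier carrier⁻¹
  disjoint_one : Disjoint (carrier ∪ carrier⁻¹) {1}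

namespace LO

variable {G : Type*} [Group G]

open Classical in
/-- The inclusion of `LO G` into `2 ^ G`, sending a positive cone to its indicator function. -/
noncomputable def toFun (P : LO G) : G → Bool := fun g => decide (g ∈ P.carrier)

/-- The topology on `LO G` as a subspace of `2 ^ G` with the product topology. -/
noncomputable instance instTopologicalSpace : TopologicalSpace (LO G) :=
  TopologicalSpace.induced toFun inferInstance

/-- The Borel structure of `LO G`. -/
noncomputable instance instMeasurableSpace : MeasurableSpace (LO G) := borel (LO G)

instance instBorelSpace : BorelSpace (LO G) := ⟨rfl⟩

theorem toFun_injective : Function.Injective (toFun : LO G → G → Bool) := by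
  intro P Q h
  ext g
  have := congrFun h g
  simpa [toFun] using this

theorem range_toFun : Set.range (toFun : LO G → G → Bool) =
    {f | (∀ a b, f a = true → f b = true → f (a * b) = true) ∧
      (∀ a, f a = true ∨ f a⁻¹ = true ∨ a = 1) ∧
      (∀ a, ¬ (f a = true ∧ f a⁻¹ = true)) ∧ ¬ f 1 = true} := by
  ext f
  constructor
  · rintro ⟨P, rfl⟩
    refine ⟨fun a b ha hb => ?_, fun a => ?_, fun a h => ?_, fun h => ?_⟩
    · simp only [toFun, decide_eq_true_eq] at ha hb ⊢
      exact P.mul_subset (Set.mul_mem_mul ha hb)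
    · simp only [toFun, decide_eq_true_eq]
      have : a ∈ P.carrier ∪ P.carrier⁻¹ ∪ {1} := P.union_eq ▸ Set.mem_univ a
      exact or_assoc.1 this
    · simp only [toFun, decide_eq_true_eq] at h
      exact Set.disjoint_left.1 P.disjoint_inv h.1 h.2
    · simp only [toFun, decide_eq_true_eq] at h
      exact Set.disjoint_left.1 P.disjoint_one (Or.inl h) rfl
  · rintro ⟨h1, h2, h3, h4⟩
    refine ⟨⟨{a | f a = true}, ?_, ?_, ?_, ?_⟩, ?_⟩
    · rintro _ ⟨a, ha, b, hb, rfl⟩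
      exact h1 a b ha hb
    · exact Set.eq_univ_of_forall fun a => or_assoc.2 (h2 a)
    · exact Set.disjoint_left.2 fun a ha hb => h3 a ⟨ha, hb⟩
    · refine Set.disjoint_left.2 fun a ha hb => h4 ?_
      obtain rfl : a = 1 := hb
      simpa using ha
    · funext a
      simp [toFun]

theorem isClosedEmbedding_toFun : IsClosedEmbedding (toFun : LO G → G → Bool) := by
  refine ⟨⟨⟨rfl⟩, toFun_injective⟩, ?_⟩
  rw [range_toFun]
  have hc : ∀ a : G, IsClopen {f : G → Bool | f a = true} := fun a =>
    (isClopen_discrete ({true} : Set Bool)).preimage (continuous_apply a)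
  have h1 : IsClosed {f : G → Bool | ∀ a b, f a = true → f b = true → f (a * b) = true} := by
    rw [Set.ofPred_forall]
    refine isClosed_iInter fun a => ?_
    rw [Set.ofPred_forall]
    exact isClosed_iInter fun b =>
      isClosed_imp (hc a).isOpen (isClosed_imp (hc b).isOpen (hc (a * b)).isClosed)
  have h2 : IsClosed {f : G → Bool | ∀ a, f a = true ∨ f a⁻¹ = true ∨ a = 1} := by
    rw [Set.ofPred_forall]
    exact isClosed_iInter fun a =>
      (hc a).isClosed.union ((hc a⁻¹).isClosed.union isClosed_const)
  have h3 : IsClosed {f : G → Bool | ∀ a, ¬ (f a = true ∧ f a⁻¹ = true)} := by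
    rw [Set.ofPred_forall]
    exact isClosed_iInter fun a => ((hc a).inter (hc a⁻¹)).compl.isClosed
  exact h1.inter (h2.inter (h3.inter (hc 1).compl.isClosed))

instance instPolishSpace [Countable G] : PolishSpace (LO G) :=
  have : SecondCountableTopology (G → Bool) := inferInstance
  have : SeparableSpace (G → Bool) := inferInstance
  have : IsCompletelyMetrizableSpace (G → Bool) := inferInstance
  isClosedEmbedding_toFun.polishSpace

end LO

/-- The equivalence relation `E_lo(G)` on `LO G`, whose classes are the orbits of the conjugation
action of `G`: `P` and `Q` are related if and only if `Q = g P g⁻¹` for some `g` in `G`. -/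
def Elo (G : Type*) [Group G] : Setoid (LO G) where
  r P Q := ∃ g : G, Q.carrier = (fun x => g * x * g⁻¹) '' P.carrier
  iseqv :=
    { refl := fun P => ⟨1, by simp⟩
      symm := by
        rintro P Q ⟨g, h⟩
        refine ⟨g⁻¹, ?_⟩
        rw [h, Set.image_image]
        simp [mul_assoc]
      trans := by
        rintro P Q R ⟨g, h⟩ ⟨k, h'⟩
        refine ⟨k * g, ?_⟩
        rw [h', h, Set.image_image]
        simp [mul_assoc] }

/-- `E ≤_B F`: the equivalence relation `E` on the standard Borel space `X` is Borel reducible to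
the equivalence relation `F` on the standard Borel space `Y`. -/
def BorelReducible {X Y : Type*} [MeasurableSpace X] [StandardBorelSpace X]
    [MeasurableSpace Y] [StandardBorelSpace Y] (E : Setoid X) (F : Setoid Y) : Prop :=
  ∃ f : X → Y, Measurable f ∧ ∀ x₀ x₁ : X, E x₀ x₁ ↔ F (f x₀) (f x₁)

/-! ### Lexicographic orderings and reductions along quotients. -/

namespace LO

variable {G H : Type*} [Group G] [Group H]

/-! Let `π : G → H` be surjective and let `G` carry a bi-ordering `Q`. Pulling `P` back along `π`
and breaking ties on the kernel by `Q` reduces `Elo H` to `Elo G`: the tie-break is conjugation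
invariant, and `P` is recovered off the kernel (`borelReducible_Elo_of_surjective`).

It remains to bi-order free groups. Transvections `1 + a X` along square-zero integer matrices embed
`FreeGroup ℕ` in the units of a polynomial ring (`injective_lift_transvectionUnit`). All values have
constant coefficient `1`, so the sign of the lowest coefficient of `g - 1` is a bi-ordering, as in
Magnus' argument with power series. -/

theorem mul_mem (P : LO G) {a b : G} (ha : a ∈ P.carrier) (hb : b ∈ P.carrier) :
    a * b ∈ P.carrier :=
  P.mul_subset (Set.mul_mem_mul ha hb)

theorem mem_or_inv_mem_or_eq_one (P : LO G) (a : G) :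
    a ∈ P.carrier ∨ a⁻¹ ∈ P.carrier ∨ a = 1 :=
  or_assoc.1 (P.union_eq ▸ Set.mem_univ a : a ∈ P.carrier ∪ P.carrier⁻¹ ∪ {1})

theorem one_notMem (P : LO G) : (1 : G) ∉ P.carrier := fun h =>
  Set.disjoint_left.1 P.disjoint_one (Or.inl h) rfl

/-- A left-ordering from the elementwise form of the axioms of a positive cone. -/
def ofMem (S : Set G) (hmul : ∀ a b, a ∈ S → b ∈ S → a * b ∈ S)
    (htri : ∀ a, a ∈ S ∨ a⁻¹ ∈ S ∨ a = 1) (hone : (1 : G) ∉ S) : LO G where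
  carrier := S
  mul_subset := by
    rintro _ ⟨a, ha, b, hb, rfl⟩
    exact hmul a b ha hb
  union_eq := Set.eq_univ_of_forall fun a => or_assoc.2 (htri a)
  disjoint_inv := Set.disjoint_left.2 fun a ha hb => hone (by simpa using hmul _ _ ha hb)
  disjoint_one := by
    refine Set.disjoint_left.2 fun a ha hb => hone ?_
    obtain rfl : a = 1 := hb
    simpa using ha

/-- A left-ordering is conjugation invariant when it is also a right-ordering. -/
def IsConjInvariant (Q : LO G) : Prop :=
  ∀ g x : G, x ∈ Q.carrier → g * x * g⁻¹ ∈ Q.carrier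

/-- The pullback of a left-ordering along an injective homomorphism. -/
def comap (f : G →* H) (hf : Function.Injective f) (Q : LO H) : LO G :=
  ofMem (f ⁻¹' Q.carrier)
    (fun a b ha hb => by simpa using Q.mul_mem ha hb)
    (fun a => by
      simpa [map_eq_one_iff f hf] using Q.mem_or_inv_mem_or_eq_one (f a))
    (by simpa using Q.one_notMem)

theorem IsConjInvariant.comap {Q : LO H} (hQ : Q.IsConjInvariant) (f : G →* H)
    (hf : Function.Injective f) : (Q.comap f hf).IsConjInvariant := fun g x hx => by
  have : f (g * x * g⁻¹) ∈ Q.carrier := by simpa using hQ (f g) (f x) hx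
  exact this

/-- The lexicographic left-ordering of `G` built from a left-ordering `P` of a quotient `H` and the
restriction to the kernel of a left-ordering `Q` of `G`. -/
def lex (π : G →* H) (Q : LO G) (P : LO H) : LO G :=
  ofMem {g | π g ∈ P.carrier ∨ π g = 1 ∧ g ∈ Q.carrier}
    (by
      rintro a b (ha | ⟨ha, ha'⟩) (hb | ⟨hb, hb'⟩)
      · exact Or.inl (by simpa using P.mul_mem ha hb)
      · exact Or.inl (by simpa [hb] using ha)
      · exact Or.inl (by simpa [ha] using hb)
      · exact Or.inr ⟨by simp [ha, hb], Q.mul_mem ha' hb'⟩)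
    (fun a => by
      rcases P.mem_or_inv_mem_or_eq_one (π a) with h | h | h
      · exact Or.inl (Or.inl h)
      · exact Or.inr (Or.inl (Or.inl (by simpa using h)))
      · rcases Q.mem_or_inv_mem_or_eq_one a with h' | h' | h'
        · exact Or.inl (Or.inr ⟨h, h'⟩)
        · exact Or.inr (Or.inl (Or.inr ⟨by simp [h], h'⟩))
        · exact Or.inr (Or.inr h'))
    (by simp [P.one_notMem, Q.one_notMem])

theorem mem_lex {π : G →* H} {Q : LO G} {P : LO H} {g : G} :
    g ∈ (lex π Q P).carrier ↔ π g ∈ P.carrier ∨ π g = 1 ∧ g ∈ Q.carrier :=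
  Iff.rfl

/-- Each coordinate of the image is constant (on the kernel) or a coordinate of `P`. -/
theorem continuous_lex (π : G →* H) (Q : LO G) : Continuous (lex π Q) := by
  refine continuous_induced_rng.2 (continuous_pi fun g => ?_)
  by_cases hg : π g = 1
  · have : (fun P : LO H => toFun (lex π Q P) g) = fun _ => toFun Q g := by
      funext P
      simp [toFun, mem_lex, hg, P.one_notMem]
    exact this ▸ continuous_const
  · have : (fun P : LO H => toFun (lex π Q P) g) = fun P => toFun P (π g) := by
      funext P
      simp [toFun, mem_lex, hg]
    refine Continuous.congr ?_ fun P => (congrFun this P).symm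
    exact (continuous_apply (π g)).comp (continuous_induced_dom (f := (toFun : LO H → _)))

end LO

theorem Elo_iff {G : Type*} [Group G] {P Q : LO G} :
    Elo G P Q ↔ ∃ g : G, ∀ x, x ∈ Q.carrier ↔ g⁻¹ * x * g ∈ P.carrier := by
  refine exists_congr fun g => Set.ext_iff.trans (forall_congr' fun x => ?_)
  have : x ∈ (fun x => g * x * g⁻¹) '' P.carrier ↔ g⁻¹ * x * g ∈ P.carrier := by
    constructor
    · rintro ⟨y, hy, rfl⟩
      simpa [mul_assoc] using hy
    · exact fun h => ⟨_, h, by simp [mul_assoc]⟩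
  rw [this]

/-- If `G` carries a conjugation invariant left-ordering, then `E_lo` of each quotient of `G`
reduces to `E_lo(G)`. -/
theorem borelReducible_Elo_of_surjective {G H : Type*} [Group G] [Group H] [Countable G]
    [Countable H] (π : G →* H) (hπ : Function.Surjective π) (Q : LO G)
    (hQ : Q.IsConjInvariant) : BorelReducible (Elo H) (Elo G) := by
  refine ⟨LO.lex π Q, (LO.continuous_lex π Q).measurable, fun P P' => ?_⟩
  rw [Elo_iff, Elo_iff]
  constructor
  · rintro ⟨h, hh⟩
    obtain ⟨g, rfl⟩ := hπ h
    refine ⟨g, fun x => ?_⟩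
    have hconj : x ∈ Q.carrier ↔ g⁻¹ * x * g ∈ Q.carrier :=
      ⟨fun hx => by simpa using hQ g⁻¹ x hx, fun hx => by simpa [mul_assoc] using hQ g _ hx⟩
    have hker : π x = 1 ↔ (π g)⁻¹ * π x * π g = 1 :=
      ⟨fun hx => by simp [hx], fun hx => by
        simpa [mul_assoc] using congrArg (fun y => π g * y * (π g)⁻¹) hx⟩
    simp only [LO.mem_lex, map_mul, map_inv]
    rw [hh, ← hker, ← hconj]
  · rintro ⟨g, hg⟩
    refine ⟨π g, fun y => ?_⟩
    obtain ⟨x, rfl⟩ := hπ y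
    -- Off the kernel the lexicographic cone is the preimage of the cone of `H`, so `Q` plays no
    -- role.
    by_cases hx : π x = 1
    · simp [hx, LO.one_notMem]
    · have hx' : (π g)⁻¹ * π x * π g ≠ 1 := fun h => hx <| by
        simpa [mul_assoc] using congrArg (fun y => π g * y * (π g)⁻¹) h
      simpa [LO.mem_lex, hx, hx'] using hg x

/-! ### Bi-orderings from lowest coefficients. -/

open Polynomial

section LowestCoeff

variable {A B : Type*} [Ring A] [AddCommGroup B] [LinearOrder B]

/-- The lowest nonzero coefficient of the polynomial has positive image under `l`. -/
def LowestCoeffPos (l : A →+ B) (p : A[X]) : Prop :=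
  ∃ (d : ℕ) (q : A[X]), p = q * X ^ d ∧ 0 < l (q.coeff 0)

variable {l : A →+ B} {p q : A[X]}

theorem LowestCoeffPos.add [IsOrderedAddMonoid B] (hp : LowestCoeffPos l p)
    (hq : LowestCoeffPos l q) : LowestCoeffPos l (p + q) := by
  have key : ∀ {d e : ℕ} {r s : A[X]}, d ≤ e → 0 < l (r.coeff 0) → 0 < l (s.coeff 0) →
      LowestCoeffPos l (r * X ^ d + s * X ^ e) := by
    intro d e r s hde hr hs
    obtain ⟨k, rfl⟩ := Nat.exists_eq_add_of_le' hde
    refine ⟨d, r + s * X ^ k, by rw [add_mul, mul_assoc, pow_add], ?_⟩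
    rcases k with _ | k
    · simpa using add_pos hr hs
    · simpa [mul_coeff_zero] using hr
  obtain ⟨d, r, rfl, hr⟩ := hp
  obtain ⟨e, s, rfl, hs⟩ := hq
  rcases le_total d e with h | h
  · exact key h hr hs
  · exact add_comm (r * X ^ d) _ ▸ key h hs hr

theorem LowestCoeffPos.mul_left (hp : LowestCoeffPos l p) (hq : q.coeff 0 = 1) :
    LowestCoeffPos l (q * p) := by
  obtain ⟨d, r, rfl, hr⟩ := hp
  exact ⟨d, q * r, (mul_assoc _ _ _).symm, by simpa [mul_coeff_zero, hq] using hr⟩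

theorem LowestCoeffPos.mul_right (hp : LowestCoeffPos l p) (hq : q.coeff 0 = 1) :
    LowestCoeffPos l (p * q) := by
  obtain ⟨d, r, rfl, hr⟩ := hp
  exact ⟨d, r * q, by rw [mul_assoc, mul_assoc, (commute_X_pow q d).eq],
    by simpa [mul_coeff_zero, hq] using hr⟩

theorem not_lowestCoeffPos_zero : ¬ LowestCoeffPos l (0 : A[X]) := by
  rintro ⟨d, q, h, hq⟩
  have := congrArg (coeff · d) h
  simp only [coeff_zero, coeff_mul_X_pow', le_refl, if_true, Nat.sub_self] at this
  simp [← this] at hq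

theorem lowestCoeffPos_or_neg [IsOrderedAddMonoid B] (hl : Function.Injective l)
    (hp : p ≠ 0) : LowestCoeffPos l p ∨ LowestCoeffPos l (-p) := by
  obtain ⟨q, hq⟩ : X ^ p.natTrailingDegree ∣ p :=
    X_pow_dvd_iff.2 fun d hd => coeff_eq_zero_of_lt_natTrailingDegree hd
  rw [X_pow_mul] at hq
  have hc : l (q.coeff 0) ≠ 0 := by
    rw [map_ne_zero_iff l hl]
    have h : p.coeff p.natTrailingDegree ≠ 0 := trailingCoeff_nonzero_iff_nonzero.2 hp
    intro h0
    have := congrArg (coeff · p.natTrailingDegree) hq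
    simp only [coeff_mul_X_pow', le_refl, if_true, Nat.sub_self, h0] at this
    exact h this
  rcases hc.lt_or_gt with h | h
  · exact Or.inr ⟨_, -q, by rw [neg_mul, ← hq], by simpa using h⟩
  · exact Or.inl ⟨_, q, hq, h⟩

/-- A group of polynomials with constant coefficient `1` over a ring whose additive group is
orderable has a conjugation invariant left-ordering. -/
theorem exists_isConjInvariant_of_injective_units {G : Type*} [Group G] [IsOrderedAddMonoid B]
    (l : A →+ B) (hl : Function.Injective l) (φ : G →* A[X]ˣ) (hφ : Function.Injective φ)
    (hc : ∀ g, (φ g : A[X]).coeff 0 = 1) : ∃ Q : LO G, Q.IsConjInvariant := by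
  refine ⟨LO.ofMem {g | LowestCoeffPos l ((φ g : A[X]) - 1)} (fun a b ha hb => ?_) (fun a => ?_)
    ?_, fun g x hx => ?_⟩
  -- `ab - 1 = a(b - 1) + (a - 1)`.
  · have := (hb.mul_left (hc a)).add ha
    rwa [mul_sub, mul_one, sub_add_sub_cancel, ← Units.val_mul, ← map_mul] at this
  · by_cases ha : a = 1
    · exact Or.inr (Or.inr ha)
    · have hne : (φ a : A[X]) - 1 ≠ 0 := fun h => ha <| hφ <| Units.ext <| by
        simpa using sub_eq_zero.1 h
      rcases lowestCoeffPos_or_neg hl hne with h | h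
      · exact Or.inl h
      -- `a⁻¹ - 1 = a⁻¹(1 - a)`.
      · have := h.mul_left (hc a⁻¹)
        rw [neg_sub, mul_sub, mul_one, ← Units.val_mul, ← map_mul, inv_mul_cancel, map_one,
          Units.val_one] at this
        exact Or.inr (Or.inl this)
  · simpa using not_lowestCoeffPos_zero
  -- `gxg⁻¹ - 1 = g(x - 1)g⁻¹`.
  · have := (LowestCoeffPos.mul_left hx (hc g)).mul_right (hc g⁻¹)
    rwa [mul_sub, sub_mul, mul_one, ← Units.val_mul, ← Units.val_mul, ← Units.val_mul, ← map_mul,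
      ← map_mul, ← map_mul, mul_inv_cancel, map_one, Units.val_one] at this

end LowestCoeff

/-! ### Free groups of transvections. -/

section PingPong

variable {A : Type*} [Ring A]

theorem C_mul_X_mul_self {a : A} (ha : a * a = 0) : C a * X * (C a * X) = 0 := by
  rw [mul_assoc, ← mul_assoc X, X_mul_C, mul_assoc, ← mul_assoc, ← C_mul, ha, C_0, zero_mul]

/-- The transvection `1 + a X` attached to an element `a` of square zero. -/
noncomputable def transvectionUnit (a : A) (ha : a * a = 0) : A[X]ˣ where
  val := 1 + C a * X
  inv := 1 - C a * X
  val_inv := by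
    rw [mul_sub, add_mul 1 _ (C a * X), C_mul_X_mul_self ha]
    simp
  inv_val := by
    rw [mul_add, sub_mul 1 _ (C a * X), C_mul_X_mul_self ha]
    simp

theorem val_transvectionUnit_zpow (a : A) (ha : a * a = 0) (n : ℤ) :
    ((transvectionUnit a ha ^ n : A[X]ˣ) : A[X]) = 1 + C (n • a) * X := by
  have hsq := C_mul_X_mul_self ha
  have hC : ∀ m : ℤ, C (m • a) * X = m • (C a * X) := fun m => by
    rw [← smul_mul_assoc, map_zsmul]
  induction n using Int.induction_on with
  | zero => simp
  | succ i ih =>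
    rw [zpow_add_one, Units.val_mul, ih, hC, hC]
    change _ * (1 + C a * X) = _
    rw [mul_add, add_mul 1 _ (C a * X), smul_mul_assoc, hsq, add_smul]
    simp [add_assoc]
  | pred i ih =>
    rw [zpow_sub_one, Units.val_mul, ih, hC, hC]
    change _ * (1 - C a * X) = _
    rw [mul_sub, add_mul 1 _ (C a * X), smul_mul_assoc, hsq, sub_smul]
    simp [sub_eq_add_neg, add_assoc]

/-- `A` may have zero divisors; the hypothesis makes `C a * X * p` have larger degree than `p`. -/
theorem leadingCoeff_one_add_C_mul_X_mul {a : A} {p : A[X]} (h : a * p.leadingCoeff ≠ 0) :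
    ((1 + C a * X) * p).leadingCoeff = a * p.leadingCoeff := by
  have hp : p ≠ 0 := by
    rintro rfl
    simp at h
  have hlead : (C a * p).leadingCoeff = a * p.leadingCoeff := by
    simpa using leadingCoeff_mul' (p := C a) (q := p) (by simpa using h)
  have hdeg : (C a * p).degree = p.degree := by
    by_cases ha : a = 0
    · simp [ha] at h
    · simpa [degree_C ha] using degree_mul' (p := C a) (q := p) (by simpa using h)
  have hlt : p.degree < (C a * p * X).degree := by
    have : Nontrivial A := ⟨_, _, h⟩
    rw [degree_mul_X, hdeg, degree_eq_natDegree hp]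
    exact_mod_cast Nat.lt_succ_self _
  rw [add_mul, one_mul, mul_assoc, X_mul, ← mul_assoc, leadingCoeff_add_of_degree_lt hlt,
    leadingCoeff_mul_X, hlead]

/-- Transvections `1 + a i X` along square-zero elements in general position generate a free
group. -/
theorem injective_lift_transvectionUnit [IsAddTorsionFree A] (a : ℕ → A)
    (ha : ∀ i, a i * a i = 0) (hne : ∀ i, a i ≠ 0)
    (hpos : ∀ i j, i ≠ j → ∀ m, a i * m = 0 → a j * m = 0 → m = 0) :
    Function.Injective (FreeGroup.lift fun i => transvectionUnit (a i) (ha i)) := by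
  have hcomp : (FreeGroup.lift fun i => transvectionUnit (a i) (ha i)) =
      (Monoid.CoprodI.lift fun i => FreeGroup.lift fun _ : Unit =>
        transvectionUnit (a i) (ha i)).comp (freeGroupEquivCoprodI (ι := ℕ)).toMonoidHom := by
    ext i
    simp
  rw [hcomp, MonoidHom.coe_comp]
  refine Function.Injective.comp ?_ (MulEquiv.injective freeGroupEquivCoprodI)
  -- The `i`-th ping-pong set consists of the nonzero polynomials whose leading coefficient is
  -- killed by `a i`. A nontrivial power of the `i`-th transvection multiplies the leading
  -- coefficient of a point of the `j`-th set by `n • a i`; the result is nonzero by `hpos`, and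
  -- killed by `a i` since `a i` squares to zero.
  refine Monoid.CoprodI.lift_injective_of_ping_pong _ (Or.inl ?_)
    (fun i => {p : A[X] | p ≠ 0 ∧ a i * p.leadingCoeff = 0}) (fun i => ?_) (fun i j hij => ?_)
    (fun i j hij => ?_)
  · rw [Cardinal.mk_nat]
    exact (Cardinal.natCast_lt_aleph0 (n := 3)).le
  · exact ⟨C (a i), by simpa using hne i, by simpa using ha i⟩
  · exact Set.disjoint_left.2 fun p hp hp' =>
      hp.1 (leadingCoeff_eq_zero.1 (hpos i j hij _ hp.2 hp'.2))
  · refine FreeGroup.freeGroupUnitEquivInt.forall_congr_left.mpr fun n hn => ?_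
    have hn0 : n ≠ 0 := by
      rintro rfl
      simp [FreeGroup.freeGroupUnitEquivInt] at hn
    rintro _ ⟨p, ⟨hp0, hp⟩, rfl⟩
    have hlc : (n • a i) * p.leadingCoeff ≠ 0 := by
      rw [smul_mul_assoc]
      exact smul_ne_zero hn0 fun h => hp0 (leadingCoeff_eq_zero.1 (hpos i j hij _ h hp))
    have hval : (FreeGroup.lift fun _ : Unit => transvectionUnit (a i) (ha i))
        (FreeGroup.freeGroupUnitEquivInt.symm n) • p = (1 + C (n • a i) * X) * p := by
      rw [← val_transvectionUnit_zpow (a i) (ha i) n]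
      change (FreeGroup.lift fun _ : Unit => transvectionUnit (a i) (ha i))
        (FreeGroup.of () ^ n) • p = _
      rw [map_zpow, FreeGroup.lift_apply_of, Units.smul_def, smul_eq_mul]
    have hlead := leadingCoeff_one_add_C_mul_X_mul hlc
    change (FreeGroup.lift fun _ : Unit => transvectionUnit (a i) (ha i))
        (FreeGroup.freeGroupUnitEquivInt.symm n) • p ∈ _
    rw [hval]
    refine ⟨fun h => hlc ?_, ?_⟩
    · rw [← hlead, h, leadingCoeff_zero]
    · rw [hlead, smul_mul_assoc, mul_smul_comm, ← mul_assoc, ha, zero_mul, smul_zero]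

end PingPong

/-! ### Integer matrices and the bi-ordering of free groups. -/

/-- The square-zero integer matrix with kernel spanned by `(1, i)`. -/
def nilMatrix (i : ℕ) : Matrix (Fin 2) (Fin 2) ℤ := !![-i, 1; -(i * i), i]

theorem nilMatrix_mul_self (i : ℕ) : nilMatrix i * nilMatrix i = 0 := by
  ext r s
  fin_cases r <;> fin_cases s <;> (simp [nilMatrix, Matrix.mul_apply, Fin.sum_univ_two]; try ring)

/-- Every column of `m` lies in both kernels, the lines through `(1, i)` and `(1, j)`, which meet
only in zero. -/
theorem eq_zero_of_nilMatrix_mul_eq_zero {i j : ℕ} (hij : i ≠ j) (m : Matrix (Fin 2) (Fin 2) ℤ)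
    (hi : nilMatrix i * m = 0) (hj : nilMatrix j * m = 0) : m = 0 := by
  have key : ∀ s, m 0 s = 0 ∧ m 1 s = 0 := fun s => by
    have h1 := congrFun (congrFun hi 0) s
    have h2 := congrFun (congrFun hj 0) s
    simp [nilMatrix, Matrix.mul_apply, Fin.sum_univ_two] at h1 h2
    have h0 : ((j : ℤ) - i) * m 0 s = 0 := by linear_combination h1 - h2
    have hne : (j : ℤ) - i ≠ 0 := sub_ne_zero.2 (by exact_mod_cast hij.symm)
    have h0' := (mul_eq_zero.1 h0).resolve_left hne
    exact ⟨h0', by simpa [h0'] using h1⟩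
  ext r s
  fin_cases r
  · exact (key s).1
  · exact (key s).2

/-- The additive embedding of the integer `2 × 2` matrices in a linearly ordered group. -/
def matrixToLex : Matrix (Fin 2) (Fin 2) ℤ →+ Lex (Fin 2 → Lex (Fin 2 → ℤ)) where
  toFun m := toLex fun r => toLex (m r)
  map_zero' := rfl
  map_add' _ _ := rfl

theorem exists_isConjInvariant_freeGroup_nat : ∃ Q : LO (FreeGroup ℕ), Q.IsConjInvariant := by
  have : IsAddTorsionFree (Matrix (Fin 2) (Fin 2) ℤ) :=
    inferInstanceAs (IsAddTorsionFree (Fin 2 → Fin 2 → ℤ))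
  have hne : ∀ i, nilMatrix i ≠ 0 := fun i h => by
    simpa [nilMatrix] using congrFun (congrFun h 0) 1
  refine exists_isConjInvariant_of_injective_units matrixToLex (fun _ _ h => h) _
    (injective_lift_transvectionUnit nilMatrix nilMatrix_mul_self hne
      fun i j hij => eq_zero_of_nilMatrix_mul_eq_zero hij) fun g => ?_
  -- Taking constant coefficients is multiplicative, so it suffices to check generators.
  have h : (Units.map (constantCoeff (R := Matrix (Fin 2) (Fin 2) ℤ)).toMonoidHom).comp
      (FreeGroup.lift fun i => transvectionUnit (nilMatrix i) (nilMatrix_mul_self i)) = 1 := by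
    ext1 i
    refine Units.ext ?_
    rw [MonoidHom.comp_apply, FreeGroup.lift_apply_of]
    change (1 + C (nilMatrix i) * X).coeff 0 = 1
    simp
  exact congrArg Units.val (DFunLike.congr_fun h g)

theorem exists_isConjInvariant_freeGroup (α : Type*) [Countable α] :
    ∃ Q : LO (FreeGroup α), Q.IsConjInvariant := by
  obtain ⟨Q, hQ⟩ := exists_isConjInvariant_freeGroup_nat
  obtain ⟨f, hf⟩ := Countable.exists_injective_nat α
  exact ⟨_, hQ.comap (FreeGroup.map f) (FreeGroup.map_injective hf)⟩

theorem borelReducible_Elo_freeGroup {α β : Type*} [Countable α] [Countable β] (f : α → β)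
    (hf : Function.Surjective f) :
    BorelReducible (Elo (FreeGroup β)) (Elo (FreeGroup α)) := by
  obtain ⟨Q, hQ⟩ := exists_isConjInvariant_freeGroup α
  exact borelReducible_Elo_of_surjective (FreeGroup.map f) (FreeGroup.map_surjective hf) Q hQ

theorem mainTheorem9 :
    (∀ n : ℕ, 2 ≤ n →
      BorelReducible (Elo (FreeGroup (Fin 2))) (Elo (FreeGroup (Fin n)))) ∧
    BorelReducible (Elo (FreeGroup (Fin 2))) (Elo (FreeGroup ℕ)) := by
  refine ⟨fun n hn => ?_, ?_⟩
  -- A left inverse of the inclusion of generators is a surjection onto `Fin 2`.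
  · exact borelReducible_Elo_freeGroup _
      (Function.invFun_surjective (Fin.castLE_injective hn))
  · exact borelReducible_Elo_freeGroup _ (Function.invFun_surjective Fin.val_injective)
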